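/- Let $K \ge 2$ and $T$ be natural numbers with $T \ge 32(K-1)\log 14$. A randomised bandit algorithm chooses, in each round $t \in \{1,\dots,T\}$, a probability distribution $p_t$ on $\{1,\dots,K\}$ as a (measurable) function of the history $(I_s,\ell_{I_s,s})_{1\le s\le t-1}$, samples an arm $I_t$ from $p_t$, and observes only the loss $\ell_{I_t,t}$ of that arm. For a loss sequence $\ell_{1:T} = (\ell_{i,t})_{1\le i\le K,\,1\le t\le T} \in [0,1]^{KT}$ the regret is \[ R_T(\ell_{1:T}) = \sum_{t=1}^T \ell_{I_t,t} - \min_{1\le i\le K} \sum_{t=1}^T \ell_{i,t}. \] Then, for any randomised bandit algorithm, there is a loss sequence $\ell_{1:T} \in [0,1]^{KT}$ such that there exists an arm $i^*$ that is optimal at every round (i.e., $\ell_{i^*,t} = \min_{1\le i\le K} \ell_{i,t}$ for all $1\le t\le T$), but \[ \mathbb{E}[R_T(\ell_{1:T})] \ge \frac{\sqrt{T(K-1)}}{504}, \] where the expectation is with respect to the randomness in the algorithm (the loss sequence is fixed). -/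

import Mathlib

/-- A randomised bandit algorithm with `K` arms and losses in `[0,1]`. At the beginning of a round
which is preceded by `t` rounds, the learner has seen the history of those `t` rounds (the arm
pulled and the loss of that arm, in each of them) and picks a probability distribution on the arms,
which is a measurable function of the history. -/
structure BanditAlgorithm (K : ℕ) where
  /-- the distribution from which the next arm is sampled, given the history -/
  policy : (t : ℕ) → (Fin t → Fin K × unitInterval) → PMF (Fin K)
  /-- each weight depends measurably on the history -/
  measurable_policy : ∀ (t : ℕ) (i : Fin K), Measurable fun h => policy t h i

namespace BanditAlgorithm

variable {K : ℕ}

/-- The law of the arms `I` pulled in `T` rounds against the fixed loss sequence `ℓ`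
(`ℓ t i` is the loss of arm `i` in round `t`): the arm of the last round is sampled from the
distribution that the algorithm computes from the arms and the observed losses of the
previous rounds. -/
noncomputable def actionLaw (A : BanditAlgorithm K) :
    (T : ℕ) → (Fin T → Fin K → unitInterval) → PMF (Fin T → Fin K)
  | 0, _ => PMF.pure Fin.elim0
  | T + 1, ℓ =>
    (actionLaw A T fun s => ℓ s.castSucc).bind fun I =>
      (A.policy T fun s => (I s, ℓ s.castSucc (I s))).map fun i =>
        (Fin.snoc I i : Fin (T + 1) → Fin K)

end BanditAlgorithm

/-- The regret of the sequence of arms `I` against the loss sequence `ℓ`. -/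
noncomputable def banditRegret {K T : ℕ} (ℓ : Fin T → Fin K → unitInterval)
    (I : Fin T → Fin K) : ℝ :=
  ∑ t, (ℓ t (I t) : ℝ) - ⨅ i : Fin K, ∑ t, (ℓ t i : ℝ)

/-- The expected regret against the loss sequence `ℓ`, where the expectation is with respect to
the randomness of the algorithm. -/
noncomputable def BanditAlgorithm.expectedRegret {K T : ℕ} (A : BanditAlgorithm K)
    (ℓ : Fin T → Fin K → unitInterval) : ℝ :=
  ∫ I, banditRegret ℓ I ∂(A.actionLaw T ℓ).toMeasure

/-!
In each round all arms show the same fair coin, except that with a small probability `ε` one arm `i`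
is granted loss `0`: arm `i` is then optimal in every round of every realisation, while each arm, on
its own, is either a fair coin or, for `i`, a coin with mean `(1 - ε) / 2`. Since the learner sees a
single arm per round, the history has the law of a stochastic bandit with these marginals. Its
divergence from the bandit with only fair coins is at most `2 / 3 * ε ^ 2` times the expected number
of pulls of `i`, which is at most `T / K` for some `i` when all coins are fair. For `ε` of order
`√(K / T)`, Pinsker's inequality shows that the learner also misses this arm in a constant fraction
of the rounds when it is the better one, at an expected cost of `ε / 2` each; some realisation of
the losses is at least as bad as the average one.
-/

open MeasureTheory ProbabilityTheory InformationTheory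

section Divergence

variable {Ω : Type*} [MeasurableSpace Ω] {μ ν : Measure Ω} [IsProbabilityMeasure μ]
  [IsProbabilityMeasure ν] {f : Ω → ℝ}

-- Donsker–Varadhan: this is `0 ≤ klDiv μ (ν.tilted f)`.
theorem integral_sub_log_integral_exp_le_toReal_klDiv (hμν : μ ≪ ν)
    (h_int : Integrable (llr μ ν) μ) (hfμ : Integrable f μ)
    (hfν : Integrable (fun x => Real.exp (f x)) ν) :
    ∫ x, f x ∂μ - Real.log (∫ x, Real.exp (f x) ∂ν) ≤ (klDiv μ ν).toReal := by
  have := isProbabilityMeasure_tilted hfν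
  have htilted := toReal_klDiv_of_measure_eq (hμν.trans (absolutelyContinuous_tilted hfν))
    (measure_univ.trans measure_univ.symm)
  rw [integral_llr_tilted_right hμν hfμ hfν h_int] at htilted
  rw [toReal_klDiv_of_measure_eq hμν (measure_univ.trans measure_univ.symm)]
  linarith [ENNReal.toReal_nonneg (a := klDiv μ (ν.tilted f))]

-- Pinsker: Donsker–Varadhan for `s * (f - ∫ f ∂ν)` and Hoeffding's lemma bound a quadratic in `s`
-- from below by `0`, so that its discriminant is nonpositive.
theorem two_mul_sq_integral_sub_integral_le_mul_toReal_klDiv (hμν : μ ≪ ν)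
    (h_int : Integrable (llr μ ν) μ) {a b : ℝ} (hf : Measurable f) (hfab : ∀ x, f x ∈ Set.Icc a b) :
    2 * (∫ x, f x ∂μ - ∫ x, f x ∂ν) ^ 2 ≤ (b - a) ^ 2 * (klDiv μ ν).toReal := by
  have hfμ : Integrable f μ := .of_mem_Icc a b hf.aemeasurable (.of_forall hfab)
  have hsub := hasSubgaussianMGF_of_mem_Icc (μ := ν) hf.aemeasurable (.of_forall hfab)
  have hquad (s : ℝ) : 0 ≤ (b - a) ^ 2 / 8 * (s * s) +
      -(∫ x, f x ∂μ - ∫ x, f x ∂ν) * s + (klDiv μ ν).toReal := by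
    have hdv := integral_sub_log_integral_exp_le_toReal_klDiv hμν h_int
      ((hfμ.sub (integrable_const (∫ x, f x ∂ν))).const_mul s) (hsub.integrable_exp_mul s)
    have hcgf := hsub.cgf_le s
    simp only [Pi.sub_apply, integral_const_mul, integral_sub hfμ (integrable_const _),
      integral_const, probReal_univ, one_smul] at hdv
    simp only [cgf, mgf, NNReal.coe_pow, NNReal.coe_div, coe_nnnorm, Real.norm_eq_abs,
      NNReal.coe_ofNat, div_pow, sq_abs] at hcgf
    linarith
  have hdiscrim := discrim_le_zero hquad
  rw [discrim] at hdiscrim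
  linarith

end Divergence

section PMF

variable {α β γ : Type*}

theorem pmf_bind_map_apply {f : α → β → γ} (hf : Function.Injective2 f) (p : PMF α) (κ : α → PMF β)
    (a : α) (b : β) : (p.bind fun x => (κ x).map (f x)) (f a b) = p a * κ a b := by
  classical
  rw [PMF.bind_apply, tsum_eq_single a, PMF.map_apply, tsum_eq_single b, if_pos rfl]
  · exact fun b' hb' => if_neg fun h => hb' (hf h).2.symm
  · intro a' ha'
    have hnotMem : f a b ∉ ((κ a').map (f a')).support := by
      rw [PMF.mem_support_map_iff]
      rintro ⟨b', -, h⟩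
      exact ha' (hf h).1
    rw [(PMF.apply_eq_zero_iff _ _).2 hnotMem, mul_zero]

theorem pmf_support_bind_map_subset {f : α → β → γ} {p q : PMF α} {κ η : α → PMF β}
    (hpq : p.support ⊆ q.support) (hκη : ∀ a, (κ a).support ⊆ (η a).support) :
    (p.bind fun a => (κ a).map (f a)).support ⊆ (q.bind fun a => (η a).map (f a)).support := by
  simp only [PMF.support_bind, PMF.support_map]
  exact Set.biUnion_mono hpq fun a _ => Set.image_mono (hκη a)

theorem pmf_support_subset_support_update {ι : Type*} [DecidableEq ι] {p q : PMF α}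
    (hpq : p.support ⊆ q.support) (i j : ι) :
    p.support ⊆ (Function.update (fun _ => p) i q j : PMF α).support := by
  rw [Function.update_apply]
  split_ifs
  exacts [hpq, subset_rfl]

theorem toReal_pmf_apply_ne_zero {p : PMF α} {a : α} (ha : a ∈ p.support) : (p a).toReal ≠ 0 :=
  ENNReal.toReal_ne_zero.2 ⟨ha, p.apply_ne_top a⟩

variable [MeasurableSpace α] [MeasurableSpace β] [MeasurableSpace γ]

theorem pmf_toMeasure_absolutelyContinuous {p q : PMF α} (hpq : p.support ⊆ q.support) :
    p.toMeasure ≪ q.toMeasure :=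
  .mk fun s hs hqs => by
    rw [PMF.toMeasure_apply_eq_zero_iff _ hs] at hqs ⊢
    exact hqs.mono_left hpq

variable [MeasurableSingletonClass α] [MeasurableSingletonClass β] [MeasurableSingletonClass γ]

theorem integral_toMeasure_congr {p : PMF α} {F G : α → ℝ} (h : ∀ a ∈ p.support, F a = G a) :
    ∫ a, F a ∂p.toMeasure = ∫ a, G a ∂p.toMeasure := by
  rw [← p.restrict_toMeasure_support]
  exact setIntegral_congr_fun p.support_countable.measurableSet h

theorem toReal_klDiv_toMeasure {p q : PMF α} (hpq : p.support ⊆ q.support) :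
    (klDiv p.toMeasure q.toMeasure).toReal =
      ∫ a, Real.log ((p a).toReal / (q a).toReal) ∂p.toMeasure := by
  have hac := pmf_toMeasure_absolutelyContinuous hpq
  rw [toReal_klDiv_of_measure_eq hac (measure_univ.trans measure_univ.symm)]
  refine integral_toMeasure_congr fun a ha => ?_
  have hrnDeriv : p.toMeasure.rnDeriv q.toMeasure a * q a = p a := by
    have hsingleton := Measure.setLIntegral_rnDeriv hac {a}
    rwa [lintegral_singleton, PMF.toMeasure_apply_singleton _ _ (measurableSet_singleton a),
      PMF.toMeasure_apply_singleton _ _ (measurableSet_singleton a)] at hsingleton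
  rw [llr_def, ← hrnDeriv, ENNReal.toReal_mul,
    mul_div_cancel_right₀ _ (toReal_pmf_apply_ne_zero (hpq ha))]

theorem integral_toMeasure_map [Countable α] [Countable β] (p : PMF α) (f : α → β) (F : β → ℝ) :
    ∫ b, F b ∂(p.map f).toMeasure = ∫ a, F (f a) ∂p.toMeasure := by
  rw [← PMF.toMeasure_map f p (measurable_of_countable f),
    integral_map (measurable_of_countable f).aemeasurable
      (measurable_of_countable F).aestronglyMeasurable]

theorem integral_toMeasure_bind [Finite α] [Finite β] (p : PMF α) (κ : α → PMF β) (F : β → ℝ) :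
    ∫ b, F b ∂(p.bind κ).toMeasure = ∫ a, ∫ b, F b ∂(κ a).toMeasure ∂p.toMeasure := by
  have := Fintype.ofFinite α
  have := Fintype.ofFinite β
  simp only [PMF.integral_eq_sum, PMF.bind_apply, tsum_fintype, smul_eq_mul, Finset.mul_sum]
  rw [Finset.sum_comm]
  refine Finset.sum_congr rfl fun b _ => ?_
  rw [ENNReal.toReal_sum fun a _ => ENNReal.mul_ne_top (p.apply_ne_top a) ((κ a).apply_ne_top b),
    Finset.sum_mul]
  simp only [ENNReal.toReal_mul, mul_assoc]

-- The chain rule for the divergence: an injective `f` loses no information about the pair.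
theorem toReal_klDiv_bind_map [Finite α] [Finite β] [Finite γ] {f : α → β → γ}
    (hf : Function.Injective2 f) {p q : PMF α} {κ η : α → PMF β}
    (hpq : p.support ⊆ q.support) (hκη : ∀ a, (κ a).support ⊆ (η a).support) :
    (klDiv (p.bind fun a => (κ a).map (f a)).toMeasure
        (q.bind fun a => (η a).map (f a)).toMeasure).toReal =
      (klDiv p.toMeasure q.toMeasure).toReal +
        ∫ a, (klDiv (κ a).toMeasure (η a).toMeasure).toReal ∂p.toMeasure := by
  rw [toReal_klDiv_toMeasure hpq, toReal_klDiv_toMeasure (pmf_support_bind_map_subset hpq hκη),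
    ← integral_add .of_finite .of_finite, integral_toMeasure_bind]
  refine integral_toMeasure_congr fun a ha => ?_
  have hsplit (b : β) (hb : b ∈ (κ a).support) :
      Real.log (((p.bind fun a => (κ a).map (f a)) (f a b)).toReal /
          ((q.bind fun a => (η a).map (f a)) (f a b)).toReal) =
        Real.log ((p a).toReal / (q a).toReal) + Real.log ((κ a b).toReal / (η a b).toReal) := by
    rw [pmf_bind_map_apply hf, pmf_bind_map_apply hf, ENNReal.toReal_mul, ENNReal.toReal_mul,
      mul_div_mul_comm, Real.log_mul]
    · exact div_ne_zero (toReal_pmf_apply_ne_zero ha) (toReal_pmf_apply_ne_zero (hpq ha))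
    · exact div_ne_zero (toReal_pmf_apply_ne_zero hb) (toReal_pmf_apply_ne_zero (hκη a hb))
  rw [integral_toMeasure_map, toReal_klDiv_toMeasure (hκη a), integral_toMeasure_congr hsplit,
    integral_add .of_finite .of_finite, integral_const, probReal_univ, one_smul]

end PMF

section Trajectory

variable {S : Type*}

/-- The law of the first `T` terms of a random sequence whose next term is sampled from `k t h`
when the first `t` terms are `h`. -/
noncomputable def trajectoryLaw (k : (t : ℕ) → (Fin t → S) → PMF S) :
    (T : ℕ) → PMF (Fin T → S)
  | 0 => PMF.pure Fin.elim0
  | T + 1 =>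
    (trajectoryLaw k T).bind fun h => (k T h).map fun s => (Fin.snoc h s : Fin (T + 1) → S)

variable {k k' : (t : ℕ) → (Fin t → S) → PMF S}

theorem support_trajectoryLaw_subset (hkk' : ∀ t h, (k t h).support ⊆ (k' t h).support) (T : ℕ) :
    (trajectoryLaw k T).support ⊆ (trajectoryLaw k' T).support := by
  induction T with
  | zero => exact subset_rfl
  | succ T ih => exact pmf_support_bind_map_subset ih (hkk' T)

variable [Finite S] [MeasurableSpace S] [MeasurableSingletonClass S]

theorem integral_trajectoryLaw_succ (T : ℕ) (F : (Fin (T + 1) → S) → ℝ) :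
    ∫ h, F h ∂(trajectoryLaw k (T + 1)).toMeasure =
      ∫ h, ∫ s, F (Fin.snoc h s) ∂(k T h).toMeasure ∂(trajectoryLaw k T).toMeasure := by
  rw [trajectoryLaw, integral_toMeasure_bind]
  simp only [integral_toMeasure_map]

theorem integral_sum_trajectoryLaw_succ (T : ℕ) (g : S → ℝ) :
    ∫ h, ∑ t, g (h t) ∂(trajectoryLaw k (T + 1)).toMeasure =
      ∫ h, ∑ t, g (h t) ∂(trajectoryLaw k T).toMeasure +
        ∫ h, ∫ s, g s ∂(k T h).toMeasure ∂(trajectoryLaw k T).toMeasure := by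
  rw [integral_trajectoryLaw_succ, ← integral_add .of_finite .of_finite]
  simp only [Fin.sum_univ_castSucc, Fin.snoc_castSucc, Fin.snoc_last,
    integral_add (integrable_const _) .of_finite, integral_const, probReal_univ, one_smul]

theorem integral_sum_trajectoryLaw_congr {g g' : S → ℝ}
    (hgg' : ∀ t h, ∫ s, g s ∂(k t h).toMeasure = ∫ s, g' s ∂(k t h).toMeasure) (T : ℕ) :
    ∫ h, ∑ t, g (h t) ∂(trajectoryLaw k T).toMeasure =
      ∫ h, ∑ t, g' (h t) ∂(trajectoryLaw k T).toMeasure := by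
  induction T with
  | zero => simp only [Finset.univ_eq_empty, Finset.sum_empty]
  | succ T ih => simp only [integral_sum_trajectoryLaw_succ, ih, hgg']

theorem toReal_klDiv_trajectoryLaw {d : S → ℝ}
    (hkk' : ∀ t h, (k t h).support ⊆ (k' t h).support)
    (hd : ∀ t h, (klDiv (k t h).toMeasure (k' t h).toMeasure).toReal =
      ∫ s, d s ∂(k t h).toMeasure) (T : ℕ) :
    (klDiv (trajectoryLaw k T).toMeasure (trajectoryLaw k' T).toMeasure).toReal =
      ∫ h, ∑ t, d (h t) ∂(trajectoryLaw k T).toMeasure := by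
  induction T with
  | zero => simp only [trajectoryLaw, klDiv_self, ENNReal.toReal_zero, Finset.univ_eq_empty,
      Finset.sum_empty, integral_zero]
  | succ T ih =>
    rw [integral_sum_trajectoryLaw_succ, ← ih, trajectoryLaw, trajectoryLaw,
      toReal_klDiv_bind_map Fin.snoc_injective2 (support_trajectoryLaw_subset hkk' T) (hkk' T)]
    simp only [hd]

end Trajectory

namespace BanditAlgorithm

theorem integral_sum_sub_sum_le_expectedRegret {K T : ℕ} (A : BanditAlgorithm K)
    (ℓ : Fin T → Fin K → unitInterval) (i : Fin K) :
    ∫ I, ∑ t, (ℓ t (I t) : ℝ) ∂(A.actionLaw T ℓ).toMeasure - ∑ t, (ℓ t i : ℝ) ≤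
      A.expectedRegret ℓ := by
  have hregret (I : Fin T → Fin K) :
      ∑ t, (ℓ t (I t) : ℝ) - ∑ t, (ℓ t i : ℝ) ≤ banditRegret ℓ I := by
    rw [banditRegret]
    gcongr
    exact ciInf_le (Set.finite_range _).bddBelow i
  have hmono := integral_mono (μ := (A.actionLaw T ℓ).toMeasure) .of_finite .of_finite hregret
  rwa [integral_sub .of_finite .of_finite, integral_const, probReal_univ, one_smul] at hmono

section StochasticBandit

variable {K : ℕ} {Z : Type*}

/-- The law of one round of a stochastic bandit, given the history: the algorithm samples an arm
and observes a feedback `z`, drawn from the distribution `ν j` of the arm `j`, which it reads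
as the loss `loss z`. -/
noncomputable def feedbackKernel (A : BanditAlgorithm K) (loss : Z → unitInterval)
    (ν : Fin K → PMF Z) (t : ℕ) (h : Fin t → Fin K × Z) : PMF (Fin K × Z) :=
  (A.policy t fun s => ((h s).1, loss (h s).2)).bind fun j => (ν j).map (Prod.mk j)

/-- The law of the history (arms and feedbacks) of `T` rounds of the stochastic bandit in which
arm `j` has feedback distribution `ν j`. -/
noncomputable def historyLaw (A : BanditAlgorithm K) (loss : Z → unitInterval)
    (ν : Fin K → PMF Z) (T : ℕ) : PMF (Fin T → Fin K × Z) :=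
  trajectoryLaw (A.feedbackKernel loss ν) T

variable (A : BanditAlgorithm K) (loss : Z → unitInterval) {ν ν' : Fin K → PMF Z}

theorem support_feedbackKernel_subset (hνν' : ∀ j, (ν j).support ⊆ (ν' j).support) (t : ℕ)
    (h : Fin t → Fin K × Z) :
    (A.feedbackKernel loss ν t h).support ⊆ (A.feedbackKernel loss ν' t h).support :=
  pmf_support_bind_map_subset subset_rfl hνν'

theorem historyLaw_succ (T : ℕ) :
    A.historyLaw loss ν (T + 1) = (A.historyLaw loss ν T).bind fun h =>
      (A.feedbackKernel loss ν T h).map fun s => (Fin.snoc h s : Fin (T + 1) → Fin K × Z) :=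
  rfl

theorem support_historyLaw_subset (hνν' : ∀ j, (ν j).support ⊆ (ν' j).support) (T : ℕ) :
    (A.historyLaw loss ν T).support ⊆ (A.historyLaw loss ν' T).support :=
  support_trajectoryLaw_subset (A.support_feedbackKernel_subset loss hνν') T

-- The arm does not depend on the outcome of its round, so the outcome may be drawn after the arm;
-- then only its marginal at that arm matters.
theorem bind_map_actionLaw_eq_historyLaw {Y : Type*} (p : PMF Y) (obs : Y → Fin K → Z) (T : ℕ) :
    ((trajectoryLaw (fun _ _ => p) T).bind fun ω =>
      (A.actionLaw T fun t j => loss (obs (ω t) j)).map fun I t => (I t, obs (ω t) (I t))) =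
      A.historyLaw loss (fun j => p.map fun y => obs y j) T := by
  induction T with
  | zero =>
    simp only [trajectoryLaw, actionLaw, historyLaw, PMF.pure_bind, PMF.pure_map]
    congr 1
    exact Subsingleton.elim _ _
  | succ T ih =>
    have hsnoc (ω : Fin T → Y) (y : Y) (I : Fin T → Fin K) (j : Fin K) :
        (fun t => ((Fin.snoc I j : Fin (T + 1) → Fin K) t,
          obs ((Fin.snoc ω y : Fin (T + 1) → Y) t) ((Fin.snoc I j : Fin (T + 1) → Fin K) t))) =
        (Fin.snoc (fun t => (I t, obs (ω t) (I t))) (j, obs y j) : Fin (T + 1) → Fin K × Z) := by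
      funext t
      cases t using Fin.lastCases <;> simp only [Fin.snoc_last, Fin.snoc_castSucc]
    rw [historyLaw_succ, ← ih, trajectoryLaw]
    simp only [actionLaw, feedbackKernel, PMF.bind_bind, PMF.bind_map, PMF.map_bind, PMF.map_comp,
      Function.comp_def, Fin.snoc_castSucc]
    congr! 2 with ω
    rw [PMF.bind_comm]
    congr! 2 with I
    simp only [PMF.map, Function.comp_def]
    rw [PMF.bind_comm]
    simp only [hsnoc]

variable [Finite Z] [MeasurableSpace Z] [MeasurableSingletonClass Z]

theorem integral_feedbackKernel (t : ℕ) (h : Fin t → Fin K × Z) (F : Fin K × Z → ℝ) :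
    ∫ s, F s ∂(A.feedbackKernel loss ν t h).toMeasure =
      ∫ j, ∫ z, F (j, z) ∂(ν j).toMeasure
        ∂(A.policy t fun s => ((h s).1, loss (h s).2)).toMeasure := by
  rw [feedbackKernel, integral_toMeasure_bind]
  simp only [integral_toMeasure_map]

theorem integral_sum_snd_historyLaw (g : Z → ℝ) (T : ℕ) :
    ∫ h, ∑ t, g (h t).2 ∂(A.historyLaw loss ν T).toMeasure =
      ∫ h, ∑ t, ∫ z, g z ∂(ν (h t).1).toMeasure ∂(A.historyLaw loss ν T).toMeasure := by
  refine integral_sum_trajectoryLaw_congr (g := fun s : Fin K × Z => g s.2)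
    (g' := fun s : Fin K × Z => ∫ z, g z ∂(ν s.1).toMeasure) (fun t h => ?_) T
  simp only [integral_feedbackKernel, integral_const, probReal_univ, one_smul]

theorem toReal_klDiv_historyLaw (hνν' : ∀ j, (ν j).support ⊆ (ν' j).support) (T : ℕ) :
    (klDiv (A.historyLaw loss ν T).toMeasure (A.historyLaw loss ν' T).toMeasure).toReal =
      ∫ h, ∑ t, (klDiv (ν (h t).1).toMeasure (ν' (h t).1).toMeasure).toReal
        ∂(A.historyLaw loss ν T).toMeasure := by
  refine toReal_klDiv_trajectoryLaw
    (d := fun s : Fin K × Z => (klDiv (ν s.1).toMeasure (ν' s.1).toMeasure).toReal)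
    (A.support_feedbackKernel_subset loss hνν') (fun t h => ?_) T
  rw [integral_feedbackKernel, feedbackKernel, feedbackKernel,
    toReal_klDiv_bind_map (fun _ _ _ _ => Prod.mk.inj) subset_rfl hνν', klDiv_self,
    ENNReal.toReal_zero, zero_add]
  simp only [integral_const, probReal_univ, one_smul]

theorem integral_pseudoRegret_le_integral_expectedRegret {Y : Type*} [Finite Y] [MeasurableSpace Y]
    [MeasurableSingletonClass Y] (p : PMF Y) (obs : Y → Fin K → Z)
    (hν : ∀ j, (p.map fun y => obs y j) = ν j) (i : Fin K) (T : ℕ) :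
    ∫ h, ∑ t,
        (∫ z, (loss z : ℝ) ∂(ν (h t).1).toMeasure - ∫ z, (loss z : ℝ) ∂(ν i).toMeasure)
        ∂(A.historyLaw loss ν T).toMeasure ≤
      ∫ ω, A.expectedRegret (fun t j => loss (obs (ω t) j))
        ∂(trajectoryLaw (fun _ _ => p) T).toMeasure := by
  have hlearner : ∫ h, ∑ t, ∫ z, (loss z : ℝ) ∂(ν (h t).1).toMeasure
        ∂(A.historyLaw loss ν T).toMeasure =
      ∫ ω, ∫ I, ∑ t, (loss (obs (ω t) (I t)) : ℝ)
        ∂(A.actionLaw T fun t j => loss (obs (ω t) j)).toMeasure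
        ∂(trajectoryLaw (fun _ _ => p) T).toMeasure := by
    rw [← A.integral_sum_snd_historyLaw loss (fun z => (loss z : ℝ)), ← funext hν,
      ← bind_map_actionLaw_eq_historyLaw, integral_toMeasure_bind]
    simp only [integral_toMeasure_map]
  have hcomparator : ∫ _, ∑ _t : Fin T, ∫ z, (loss z : ℝ) ∂(ν i).toMeasure
        ∂(A.historyLaw loss ν T).toMeasure =
      ∫ ω, ∑ t, (loss (obs (ω t) i) : ℝ) ∂(trajectoryLaw (fun _ _ => p) T).toMeasure := by
    rw [integral_sum_trajectoryLaw_congr (g := fun y => (loss (obs y i) : ℝ))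
      (g' := fun _ => ∫ y, (loss (obs y i) : ℝ) ∂p.toMeasure)
      (fun _ _ => by rw [integral_const, probReal_univ, one_smul])]
    simp only [← hν i, integral_toMeasure_map, integral_const, probReal_univ, one_smul]
  simp only [Finset.sum_sub_distrib]
  rw [integral_sub .of_finite .of_finite, hlearner, hcomparator,
    ← integral_sub .of_finite .of_finite]
  exact integral_mono .of_finite .of_finite fun ω =>
    A.integral_sum_sub_sum_le_expectedRegret _ i

end StochasticBandit

section OneBetterArm

variable {K T : ℕ} {Z : Type*}

/-- The number of pulls of arm `i` in the history `h`, as a real number. -/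
noncomputable def numPulls (i : Fin K) (h : Fin T → Fin K × Z) : ℝ :=
  ∑ t, if (h t).1 = i then 1 else 0

theorem sum_numPulls (h : Fin T → Fin K × Z) : ∑ i, numPulls i h = T := by
  simp only [numPulls]
  rw [Finset.sum_comm]
  simp

theorem numPulls_mem_Icc (i : Fin K) (h : Fin T → Fin K × Z) :
    numPulls i h ∈ Set.Icc (0 : ℝ) T := by
  have hnonneg (j : Fin K) : 0 ≤ numPulls j h :=
    Finset.sum_nonneg fun t _ => by split_ifs <;> simp
  refine ⟨hnonneg i, ?_⟩
  rw [← sum_numPulls h]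
  exact Finset.single_le_sum (fun j _ => hnonneg j) (Finset.mem_univ i)

variable [Finite Z] [MeasurableSpace Z] [MeasurableSingletonClass Z]

theorem exists_integral_numPulls_le (hK : 0 < K) (q : PMF (Fin T → Fin K × Z)) :
    ∃ i, ∫ h, numPulls i h ∂q.toMeasure ≤ T / K := by
  have hKT : (T : ℝ) = K * (T / K) := by field_simp
  have hsum : ∑ i, ∫ h, numPulls i h ∂q.toMeasure = ∑ _i : Fin K, (T / K : ℝ) := by
    rw [← integral_finsetSum _ fun _ _ => .of_finite]
    simp only [sum_numPulls, integral_const, probReal_univ, one_smul, Finset.sum_const,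
      Finset.card_univ, Fintype.card_fin, nsmul_eq_mul]
    exact hKT
  obtain ⟨i, -, hi⟩ := Finset.exists_le_of_sum_le ⟨⟨0, hK⟩, Finset.mem_univ _⟩ hsum.le
  exact ⟨i, hi⟩

variable (A : BanditAlgorithm K) (loss : Z → unitInterval) {p₀ p₁ : PMF Z}

theorem toReal_klDiv_historyLaw_update (hp : p₀.support ⊆ p₁.support) (i : Fin K) :
    (klDiv (A.historyLaw loss (fun _ => p₀) T).toMeasure
        (A.historyLaw loss (Function.update (fun _ => p₀) i p₁) T).toMeasure).toReal =
      (klDiv p₀.toMeasure p₁.toMeasure).toReal *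
        ∫ h, numPulls i h ∂(A.historyLaw loss (fun _ => p₀) T).toMeasure := by
  rw [A.toReal_klDiv_historyLaw loss (pmf_support_subset_support_update hp i), ← integral_const_mul]
  simp only [numPulls, Finset.mul_sum, Function.update_apply]
  congr! 3 with _ t
  split_ifs <;> simp

theorem two_mul_sq_integral_numPulls_sub_le (hp : p₀.support ⊆ p₁.support) (i : Fin K) :
    2 * (∫ h, numPulls i h ∂(A.historyLaw loss (fun _ => p₀) T).toMeasure -
        ∫ h, numPulls i h
          ∂(A.historyLaw loss (Function.update (fun _ => p₀) i p₁) T).toMeasure) ^ 2 ≤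
      T ^ 2 * ((klDiv p₀.toMeasure p₁.toMeasure).toReal *
        ∫ h, numPulls i h ∂(A.historyLaw loss (fun _ => p₀) T).toMeasure) := by
  rw [← toReal_klDiv_historyLaw_update A loss hp, ← sub_zero (T : ℝ)]
  have hsupp := A.support_historyLaw_subset loss (pmf_support_subset_support_update hp i) T
  exact two_mul_sq_integral_sub_integral_le_mul_toReal_klDiv
    (pmf_toMeasure_absolutelyContinuous hsupp) .of_finite (measurable_of_countable _)
    (numPulls_mem_Icc i)

theorem mul_sub_integral_numPulls_le_integral_expectedRegret {Y : Type*} [Finite Y]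
    [MeasurableSpace Y] [MeasurableSingletonClass Y] (p : PMF Y) (obs : Y → Fin K → Z) (i : Fin K)
    (hobs : ∀ j, (p.map fun y => obs y j) = Function.update (fun _ => p₀) i p₁ j) :
    (∫ z, (loss z : ℝ) ∂p₀.toMeasure - ∫ z, (loss z : ℝ) ∂p₁.toMeasure) *
        (T - ∫ h, numPulls i h
          ∂(A.historyLaw loss (Function.update (fun _ => p₀) i p₁) T).toMeasure) ≤
      ∫ ω, A.expectedRegret (fun t j => loss (obs (ω t) j))
        ∂(trajectoryLaw (fun _ _ => p) T).toMeasure := by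
  refine (Eq.le ?_).trans (A.integral_pseudoRegret_le_integral_expectedRegret loss p obs hobs i T)
  set m₀ := ∫ z, (loss z : ℝ) ∂p₀.toMeasure with hm₀
  set m₁ := ∫ z, (loss z : ℝ) ∂p₁.toMeasure with hm₁
  have hgap (j : Fin K) :
      ∫ z, (loss z : ℝ) ∂(Function.update (fun _ => p₀) i p₁ j : PMF Z).toMeasure - m₁ =
        (m₀ - m₁) * (1 - if j = i then 1 else 0) := by
    rw [Function.update_apply]
    split_ifs
    · rw [← hm₁, sub_self, sub_self, mul_zero]
    · rw [← hm₀, sub_zero, mul_one]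
  rw [Function.update_self]
  simp only [← hm₁, hgap, ← Finset.mul_sum, Finset.sum_sub_distrib, integral_const_mul, numPulls]
  rw [integral_sub .of_finite .of_finite]
  simp

end OneBetterArm

end BanditAlgorithm

section Coins

/-- The loss of an arm of the hard bandit instance, whose feedbacks are Booleans. -/
def boolLoss (b : Bool) : unitInterval :=
  if b then 1 else 0

/-- The law of the loss of the other arms of the hard bandit instance. -/
noncomputable abbrev fairCoin : PMF Bool :=
  PMF.uniformOfFintype Bool

/-- The law of the randomness of a round of the hard bandit instance: a fair coin and an
independent discount, which takes place with probability `ε`. -/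
noncomputable def coinWithDiscount (ε : unitInterval) : PMF (Bool × Bool) :=
  fairCoin.bind fun c => (bernoulliMeasure true false ε).toPMF.map (Prod.mk c)

/-- The law of the loss of the better arm of the hard bandit instance: that of a fair coin that is
reset to `false` by a discount. -/
noncomputable def discountedCoin (ε : unitInterval) : PMF Bool :=
  (coinWithDiscount ε).map fun y => y.1 && !y.2

variable (ε : unitInterval)

theorem map_fst_coinWithDiscount : (coinWithDiscount ε).map Prod.fst = fairCoin := by
  have hconst (c : Bool) :
      ((bernoulliMeasure true false ε).toPMF.map (Prod.mk c)).map Prod.fst = PMF.pure c := by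
    rw [PMF.map_comp]
    exact PMF.map_const _ c
  simp only [coinWithDiscount, PMF.map_bind, hconst, PMF.bind_pure]

theorem integral_fairCoin (F : Bool → ℝ) :
    ∫ b, F b ∂fairCoin.toMeasure = 1 / 2 * F true + 1 / 2 * F false := by
  simp [PMF.integral_eq_sum]

theorem integral_discountedCoin (F : Bool → ℝ) :
    ∫ b, F b ∂(discountedCoin ε).toMeasure = (1 - ε) / 2 * F true + (1 + ε) / 2 * F false := by
  rw [discountedCoin, integral_toMeasure_map, coinWithDiscount, integral_toMeasure_bind,
    integral_fairCoin]
  simp only [integral_toMeasure_map, Measure.toPMF_toMeasure, integral_bernoulliMeasure,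
    smul_eq_mul, Bool.not_true, Bool.not_false, Bool.and_true, Bool.and_false]
  ring

theorem toReal_discountedCoin_apply (b : Bool) :
    (discountedCoin ε b).toReal = if b then (1 - ε : ℝ) / 2 else (1 + ε) / 2 := by
  have hmass := integral_discountedCoin ε fun b' => if b' = b then 1 else 0
  rw [PMF.integral_eq_sum] at hmass
  cases b <;> simpa using hmass

variable {ε}

theorem support_fairCoin_subset (hε : (ε : ℝ) < 1) :
    fairCoin.support ⊆ (discountedCoin ε).support := by
  intro b _ hb
  have hmass := toReal_discountedCoin_apply ε b
  rw [hb, ENNReal.toReal_zero] at hmass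
  split_ifs at hmass <;> linarith [ε.2.1]

theorem toReal_klDiv_fairCoin (hε : (ε : ℝ) < 1) :
    (klDiv fairCoin.toMeasure (discountedCoin ε).toMeasure).toReal =
      -Real.log (1 - (ε : ℝ) ^ 2) / 2 := by
  have hε₀ := ε.2.1
  have hmass (b : Bool) : (fairCoin b).toReal = 1 / 2 := by simp
  have hratio (x : ℝ) : Real.log (1 / 2 / (x / 2)) = -Real.log x := by
    rw [div_div_div_cancel_right₀ two_ne_zero, one_div, Real.log_inv]
  have hfactor : 1 - (ε : ℝ) ^ 2 = (1 - ε) * (1 + ε) := by ring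
  rw [toReal_klDiv_toMeasure (support_fairCoin_subset hε), integral_fairCoin, hfactor,
    Real.log_mul (by linarith) (by linarith)]
  simp only [toReal_discountedCoin_apply, hmass, if_true, Bool.false_eq_true, if_false, hratio]
  ring

theorem toReal_klDiv_fairCoin_le (hε : (ε : ℝ) ≤ 1 / 2) :
    (klDiv fairCoin.toMeasure (discountedCoin ε).toMeasure).toReal ≤ 2 / 3 * (ε : ℝ) ^ 2 := by
  have hε₀ := ε.2.1
  have hsq : 3 / 4 ≤ 1 - (ε : ℝ) ^ 2 := by nlinarith
  have hlog := Real.one_sub_inv_le_log_of_pos (x := 1 - (ε : ℝ) ^ 2) (by linarith)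
  have hinv : (1 - (ε : ℝ) ^ 2)⁻¹ ≤ 1 + 4 / 3 * (ε : ℝ) ^ 2 :=
    (inv_le_iff_one_le_mul₀ (by linarith)).2 (by nlinarith)
  rw [toReal_klDiv_fairCoin (by linarith)]
  linarith

end Coins

namespace BanditAlgorithm

section HardInstance

variable {K T : ℕ}

/-- The losses of a round of the hard bandit instance with better arm `i`: all arms share the same
coin, and only `i` benefits from the discount, so that `i` is optimal in every single round. -/
def hardLoss (i : Fin K) (y : Bool × Bool) (j : Fin K) : Bool :=
  if j = i then y.1 && !y.2 else y.1

/-- The law of the history of `T` rounds of the hard bandit instance with better arm `i`. -/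
noncomputable def hardHistoryLaw (A : BanditAlgorithm K) (ε : unitInterval) (i : Fin K) (T : ℕ) :
    PMF (Fin T → Fin K × Bool) :=
  A.historyLaw boolLoss (Function.update (fun _ => fairCoin) i (discountedCoin ε)) T

theorem boolLoss_hardLoss_self_le (i j : Fin K) (y : Bool × Bool) :
    boolLoss (hardLoss i y i) ≤ boolLoss (hardLoss i y j) := by
  obtain ⟨c, b⟩ := y
  cases c <;> cases b <;> simp [hardLoss, boolLoss]

theorem map_hardLoss_coinWithDiscount (ε : unitInterval) (i j : Fin K) :
    ((coinWithDiscount ε).map fun y => hardLoss i y j) =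
      Function.update (fun _ => fairCoin) i (discountedCoin ε) j := by
  rw [Function.update_apply]
  unfold hardLoss
  split_ifs
  exacts [rfl, map_fst_coinWithDiscount ε]

variable (A : BanditAlgorithm K) (ε : unitInterval)

theorem exists_mul_sub_integral_numPulls_le_expectedRegret (i : Fin K) :
    ∃ ℓ : Fin T → Fin K → unitInterval, (∀ t j, ℓ t i ≤ ℓ t j) ∧
      (ε : ℝ) / 2 * (T - ∫ h, numPulls i h ∂(A.hardHistoryLaw ε i T).toMeasure) ≤
        A.expectedRegret ℓ := by
  have hgap : ∫ b, (boolLoss b : ℝ) ∂fairCoin.toMeasure -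
      ∫ b, (boolLoss b : ℝ) ∂(discountedCoin ε).toMeasure = (ε : ℝ) / 2 := by
    rw [integral_fairCoin, integral_discountedCoin]
    simp only [boolLoss, if_true, Bool.false_eq_true, if_false, Set.Icc.coe_one, Set.Icc.coe_zero]
    ring
  have hregret := A.mul_sub_integral_numPulls_le_integral_expectedRegret (T := T) boolLoss _ _ i
    (map_hardLoss_coinWithDiscount ε i)
  rw [hgap] at hregret
  obtain ⟨ω, hω⟩ := exists_integral_le
    (f := fun ω : Fin T → Bool × Bool => A.expectedRegret fun t j => boolLoss (hardLoss i (ω t) j))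
    (μ := (trajectoryLaw (fun _ _ => coinWithDiscount ε) T).toMeasure) .of_finite
  exact ⟨fun t j => boolLoss (hardLoss i (ω t) j), fun t j => boolLoss_hardLoss_self_le i j (ω t),
    hregret.trans hω⟩

variable {ε}

theorem exists_integral_numPulls_hardHistoryLaw_le (hK : 2 ≤ K) (hε : (ε : ℝ) ≤ 1 / 2)
    (hεT : (ε : ℝ) ^ 2 * T ≤ (K - 1) / 4) :
    ∃ i, ∫ h, numPulls i h ∂(A.hardHistoryLaw ε i T).toMeasure ≤ 4 / 5 * T := by
  obtain ⟨i, hi⟩ := exists_integral_numPulls_le (by lia)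
    (A.historyLaw boolLoss (fun _ => fairCoin) T)
  refine ⟨i, ?_⟩
  have hpinsker := A.two_mul_sq_integral_numPulls_sub_le (T := T) boolLoss
    (support_fairCoin_subset (hε.trans_lt one_half_lt_one)) i
  rw [← hardHistoryLaw] at hpinsker
  set N := ∫ h, numPulls i h ∂(A.historyLaw boolLoss (fun _ => fairCoin) T).toMeasure
  set N' := ∫ h, numPulls i h ∂(A.hardHistoryLaw ε i T).toMeasure
  have hK' : (2 : ℝ) ≤ K := mod_cast hK
  have hN₀ : 0 ≤ N := integral_nonneg fun h => (numPulls_mem_Icc i h).1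
  have hN : N ≤ T / 2 := hi.trans (by gcongr)
  have hdiv : (klDiv fairCoin.toMeasure (discountedCoin ε).toMeasure).toReal * N ≤
      1 / 6 :=
    calc _ ≤ 2 / 3 * (ε : ℝ) ^ 2 * (T / K) := by gcongr; exact toReal_klDiv_fairCoin_le hε
      _ = 2 / 3 * ((ε : ℝ) ^ 2 * T) / K := by ring
      _ ≤ 2 / 3 * (((K : ℝ) - 1) / 4) / K := by gcongr
      _ ≤ 1 / 6 := by rw [div_le_iff₀ (by linarith)]; linarith
  have hsq : (N' - N) ^ 2 ≤ (3 / 10 * T : ℝ) ^ 2 := by nlinarith [sq_nonneg (T : ℝ)]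
  linarith [abs_le_of_sq_le_sq' hsq (by positivity)]

theorem exists_div_le_expectedRegret_of_sq_le {m : ℝ} (hK : 2 ≤ K) (hm₀ : 0 ≤ m) (hmT : m ≤ T)
    (hm : m ^ 2 ≤ T * (K - 1)) :
    ∃ ℓ : Fin T → Fin K → unitInterval, (∃ i, ∀ t j, ℓ t i ≤ ℓ t j) ∧
      m / 20 ≤ A.expectedRegret ℓ := by
  have hK' : (2 : ℝ) ≤ K := mod_cast hK
  have hε : m / (2 * T) ≤ 1 / 2 := div_le_of_le_mul₀ (by positivity) (by positivity) (by linarith)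
  have hεT : m / (2 * T) * T = m / 2 := by
    rcases T.eq_zero_or_pos with rfl | hT
    · simp [le_antisymm (hmT.trans_eq Nat.cast_zero) hm₀]
    · field_simp
  have hbudget : (m / (2 * T)) ^ 2 * T ≤ (K - 1) / 4 :=
    calc (m / (2 * T)) ^ 2 * T = m / (2 * T) * (m / (2 * T) * T) := by ring
      _ = m ^ 2 / T / 4 := by rw [hεT]; ring
      _ ≤ (K - 1) / 4 := by
        gcongr
        exact div_le_of_le_mul₀ (by positivity) (by linarith) (by linarith)
  let ε : unitInterval := ⟨m / (2 * T), by positivity, hε.trans (by norm_num)⟩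
  obtain ⟨i, hi⟩ := A.exists_integral_numPulls_hardHistoryLaw_le (ε := ε) hK hε hbudget
  obtain ⟨ℓ, hopt, hregret⟩ := A.exists_mul_sub_integral_numPulls_le_expectedRegret (T := T) ε i
  refine ⟨ℓ, ⟨i, hopt⟩, le_trans ?_ hregret⟩
  calc m / 20 = m / (2 * T) / 2 * (T - 4 / 5 * T) := by linear_combination (-1 / 10) * hεT
    _ ≤ _ := by gcongr

end HardInstance

end BanditAlgorithm

theorem corollary5_general (K T : ℕ) (hK : 2 ≤ K) (A : BanditAlgorithm K) :
    ∃ ℓ : Fin T → Fin K → unitInterval,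
      (∃ i : Fin K, ∀ (t : Fin T) (j : Fin K), ℓ t i ≤ ℓ t j) ∧
      min √((T : ℝ) * ((K : ℝ) - 1)) T / 20 ≤ A.expectedRegret ℓ := by
  have hK' : (2 : ℝ) ≤ K := mod_cast hK
  have hprod : (0 : ℝ) ≤ T * (K - 1) := mul_nonneg T.cast_nonneg (by linarith)
  exact A.exists_div_le_expectedRegret_of_sq_le hK (by positivity) (min_le_right _ _)
    ((Real.le_sqrt (by positivity) hprod).1 (min_le_left _ _))

theorem sqrt_mul_le_of_mul_log_le {t x : ℝ} (hx : 0 ≤ x) (hxt : 32 * x * Real.log 14 ≤ t) :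
    √(t * x) ≤ t := by
  have hlog := Real.one_sub_inv_le_log_of_pos (x := 14) (by norm_num)
  have hxt' : x ≤ t := by nlinarith
  exact Real.sqrt_le_iff.2 ⟨hx.trans hxt', by nlinarith⟩

theorem corollary5 (K T : ℕ) (hK : 2 ≤ K)
    (hT : 32 * ((K : ℝ) - 1) * Real.log 14 ≤ (T : ℝ)) (A : BanditAlgorithm K) :
    ∃ ℓ : Fin T → Fin K → unitInterval,
      (∃ i : Fin K, ∀ (t : Fin T) (j : Fin K), ℓ t i ≤ ℓ t j) ∧
      √((T : ℝ) * ((K : ℝ) - 1)) / 504 ≤ A.expectedRegret ℓ := by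
  obtain ⟨ℓ, hopt, hregret⟩ := corollary5_general K T hK A
  rw [min_eq_left (sqrt_mul_le_of_mul_log_le (sub_nonneg.2 (mod_cast by lia)) hT)] at hregret
  exact ⟨ℓ, hopt, by linarith [Real.sqrt_nonneg ((T : ℝ) * ((K : ℝ) - 1))]⟩
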